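/- Let $p$ be a prime and let $\mathbb{Q}_p$ be the field of $p$-adic numbers with norm $|\cdot|_p$. For a probability measure $\mu$ on (the Borel sets of) $\mathbb{Q}_p$, its characteristic function is $\hat\mu(y)=\int_{\mathbb{Q}_p}(x,y)\,d\mu(x)$, where $y$ runs over the character group of the additive group $\mathbb{Q}_p$ and $(x,y)$ is the value of the character $y$ at $x$; the characteristic function of a random variable is that of its distribution. Let $a_2,a_3,b_2,b_3$ be nonzero elements of $\mathbb{Q}_p$. Let $\xi_1,\xi_2,\xi_3,\xi_4$ be independent $\mathbb{Q}_p$-valued random variables with nonvanishing characteristic functions, and put $L_1=\xi_1+a_2\xi_2+a_3\xi_3$, $L_2=b_2\xi_2+b_3\xi_3+\xi_4$. Assume that one of the following conditions holds: (I) $a_2b_3\neq a_3b_2$; (II) $a_2b_3=a_3b_2$, $|a_2|_p\neq|a_3|_p$, and $\xi_2$ and $\xi_3$ are identically distributed. Then the distribution of the random vector $(L_1,L_2)$ determines the distributions of $\xi_1,\xi_2,\xi_3,\xi_4$ up to shift. That is: let $\eta_1,\eta_2,\eta_3,\eta_4$ be independent $\mathbb{Q}_p$-valued random variables (possibly on another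 probability space) with nonvanishing characteristic functions, where in case (II) also $\eta_2$ and $\eta_3$ are identically distributed, and put $M_1=\eta_1+a_2\eta_2+a_3\eta_3$, $M_2=b_2\eta_2+b_3\eta_3+\eta_4$. If $(M_1,M_2)$ and $(L_1,L_2)$ have the same distribution, then for each $j=1,2,3,4$ there is $c_j\in\mathbb{Q}_p$ such that $\eta_j$ has the same distribution as $\xi_j+c_j$. -/

import Mathlib

/-- The characteristic function `μ̂(y) = ∫ (x, y) dμ(x)` of a measure `μ` on an additive
topological Abelian group `X`. The argument `y` runs over the character group of `X`, i.e. over the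
continuous homomorphisms from `X` (written multiplicatively) to the unit circle. -/
noncomputable def groupCharFun {X : Type*} [AddCommGroup X] [TopologicalSpace X]
    [MeasurableSpace X] (μ : MeasureTheory.Measure X)
    (y : PontryaginDual (Multiplicative X)) : ℂ :=
  ∫ x, (y (Multiplicative.ofAdd x) : ℂ) ∂μ

/-- `ν` is a shift of `μ`: it is the image of `μ` under a translation `x ↦ x + c`. -/
def IsShiftOf {X : Type*} [AddCommGroup X] [MeasurableSpace X]
    (ν μ : MeasureTheory.Measure X) : Prop :=
  ∃ c : X, ν = μ.map (fun x => x + c)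

/-! Let `h j` be the quotient of the characteristic functions of `η j` and `ξ j`, with the dual of
ℚ_p parametrized by a fixed character `ψ`. By independence, equality of the two laws gives
h₀(u)·h₁(a₂u+b₂v)·h₂(a₃u+b₃v)·h₃(v) = 1. Setting v = 0 or u = 0 expresses h₀ and h₃ through h₁ and
h₂, so it suffices that h₁ and h₂ are characters.

In case (I) a shift of (u, v) along the kernel of one form eliminates the other factor. Third
differences of h₁ and h₂ are then trivial (`third_difference_of_split`), and Hermitian symmetry
kills the quadratic part (`Padic.map_add_of_third_difference`). In case (II) h₁ = h₂ = h, and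
h(s)h(αs) is a character with α = a₃/a₂ = b₃/b₂; since |α| ≠ 1, contraction to 0 shows that h is one
(`Padic.exists_eq_addChar_of_mul_comp`).

Every character is ψ(c·) (`Padic.exists_eq_addChar`), the transform of a unit mass at c, so
uniqueness of the transform turns each quotient into a shift. -/

/-! ### Characters of ℚ_p -/

/-- There is an additive character of `ℚ_[p]` which is trivial on the closed unit ball but not at
`p⁻¹`. -/
theorem Padic.exists_addChar (p : ℕ) [Fact p.Prime] :
    ∃ ψ : AddChar ℚ_[p] Circle, (∀ x, ‖x‖ ≤ 1 → ψ x = 1) ∧ ψ (p : ℚ_[p])⁻¹ ≠ 1 := by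
  let Z : AddSubgroup ℚ_[p] := (PadicInt.subring p).toAddSubgroup
  have hmem : ∀ x, x ∈ Z ↔ ‖x‖ ≤ 1 := fun x => Iff.rfl
  have hp : (((p : ℚ_[p])⁻¹ : ℚ_[p]) : ℚ_[p] ⧸ Z) ≠ 0 := by
    rw [Ne, QuotientAddGroup.eq_zero_iff, hmem, norm_inv, Padic.norm_p, inv_inv, not_le]
    exact_mod_cast (Fact.out : p.Prime).one_lt
  obtain ⟨c, hc⟩ := CharacterModule.exists_character_apply_ne_zero_of_ne_zero hp
  -- The character `c` of ℚ_p/ℤ_p takes values in ℚ/ℤ; embedding these in ℝ/ℤ keeps its value at p⁻¹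
  -- nonzero.
  let i : AddCircle (1 : ℚ) →+ AddCircle (1 : ℝ) :=
    QuotientAddGroup.map _ _ (Rat.castHom ℝ).toAddMonoidHom (by
      rintro x ⟨n, rfl⟩
      exact ⟨n, by simp⟩)
  have hi : ∀ x, i x = 0 → x = 0 := by
    intro x
    induction x using QuotientAddGroup.induction_on with
    | H q =>
      intro h
      obtain ⟨n, hn⟩ := (QuotientAddGroup.eq_zero_iff _).1 h
      refine (QuotientAddGroup.eq_zero_iff _).2 ⟨n, ?_⟩
      have h' : ((n • (1 : ℚ) : ℚ) : ℝ) = q := by simpa using hn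
      exact_mod_cast h'
  let φ : ℚ_[p] →+ AddCircle (1 : ℝ) := i.comp ((c : _ →+ _).comp (QuotientAddGroup.mk' Z))
  refine ⟨⟨fun x => (φ x).toCircle, by simp, fun x y => by
    rw [map_add, AddCircle.toCircle_add]⟩, fun x hx => ?_, fun h => hc (hi _ ?_)⟩
  · have : (QuotientAddGroup.mk' Z) x = 0 := (QuotientAddGroup.eq_zero_iff _).2 hx
    change (i (c (QuotientAddGroup.mk' Z x))).toCircle = 1
    rw [this, map_zero, map_zero, AddCircle.toCircle_zero]
  · apply AddCircle.injective_toCircle one_ne_zero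
    rw [AddCircle.toCircle_zero]
    exact h

/-- The powers of a complex number different from `1` do not all stay close to `1`. -/
theorem Complex.eq_one_of_norm_pow_sub_one_le {z : ℂ} (h : ∀ n : ℕ, ‖z ^ n - 1‖ ≤ 1 / 2) :
    z = 1 := by
  -- Squaring w multiplies its distance from 1 by |w + 1| ≥ 3/2.
  have key : ∀ n : ℕ, (3 / 2 : ℝ) ^ n * ‖z - 1‖ ≤ ‖z ^ 2 ^ n - 1‖ := by
    intro n
    induction n with
    | zero => simp
    | succ n ih =>
      set w := z ^ 2 ^ n with hw
      have h1 : z ^ 2 ^ (n + 1) - 1 = (w + 1) * (w - 1) := by rw [hw, pow_succ, pow_mul]; ring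
      have h2 : 3 / 2 ≤ ‖w + 1‖ := by
        have h3 : ‖(2 : ℂ)‖ ≤ ‖w + 1‖ + ‖w - 1‖ := by
          have h4 : (2 : ℂ) = (w + 1) - (w - 1) := by ring
          rw [h4]
          exact norm_sub_le _ _
        have := h (2 ^ n)
        rw [Complex.norm_ofNat] at h3
        linarith
      rw [h1, norm_mul, pow_succ, mul_comm _ (3 / 2 : ℝ), mul_assoc]
      gcongr
  by_contra hz
  have hpos : 0 < ‖z - 1‖ := norm_pos_iff.2 (sub_ne_zero.2 hz)
  obtain ⟨n, hn⟩ := pow_unbounded_of_one_lt (1 / 2 / ‖z - 1‖) (by norm_num : (1 : ℝ) < 3 / 2)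
  rw [div_lt_iff₀ hpos] at hn
  linarith [key n, h (2 ^ n)]

section

variable {p : ℕ} [Fact p.Prime]

theorem Padic.addChar_continuous {ψ : AddChar ℚ_[p] Circle} (hψ : ∀ x, ‖x‖ ≤ 1 → ψ x = 1) :
    Continuous ψ := by
  rw [continuous_iff_continuousAt]
  intro x
  refine (continuousAt_const (y := ψ x)).congr ?_
  filter_upwards [Metric.closedBall_mem_nhds x one_pos] with y hy
  have hyx : ψ (y - x) = 1 := hψ _ (by simpa [dist_eq_norm] using hy)
  rw [← sub_add_cancel y x, AddChar.map_add_eq_mul, hyx, one_mul]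

theorem Padic.norm_natCast_le_one (n : ℕ) : ‖(n : ℚ_[p])‖ ≤ 1 := by
  simpa using Padic.norm_int_le_one (p := p) n

/-- A continuous multiplicative function on `ℚ_[p]` takes values in the unit circle. -/
theorem Padic.norm_eq_one_of_map_add {f : ℚ_[p] → ℂ} (hf : Continuous f) (h0 : f 0 = 1)
    (hadd : ∀ x y, f (x + y) = f x * f y) (x : ℚ_[p]) : ‖f x‖ = 1 := by
  have hpow : ∀ (n : ℕ) x, f (n * x) = f x ^ n := by
    intro n x
    induction n with
    | zero => simp [h0]
    | succ n ih => rw [Nat.cast_succ, add_mul, one_mul, hadd, ih, pow_succ]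
  have hle : ∀ x, ‖f x‖ ≤ 1 := by
    intro x
    -- All multiples n·x stay in a compact ball, so the powers of `f x` are bounded.
    obtain ⟨C, hC⟩ := (isCompact_closedBall (0 : ℚ_[p]) ‖x‖).exists_bound_of_continuousOn
      hf.continuousOn
    by_contra! h
    obtain ⟨n, hn⟩ := pow_unbounded_of_one_lt C h
    have := hC (n * x) (by
      rw [mem_closedBall_zero_iff, norm_mul]
      exact mul_le_of_le_one_left (norm_nonneg _) (Padic.norm_natCast_le_one n))
    rw [hpow, norm_pow] at this
    linarith
  have h1 : ‖f x‖ * ‖f (-x)‖ = 1 := by rw [← norm_mul, ← hadd]; simp [h0]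
  have := hle x
  have := hle (-x)
  nlinarith [norm_nonneg (f x)]

/-- A continuous multiplicative function on `ℚ_[p]` that is trivial on the closed unit ball has the
form `x ↦ ψ (c * x)`. -/
theorem Padic.exists_eq_addChar_of_trivial {ψ : AddChar ℚ_[p] Circle}
    (hψ : ∀ x, ‖x‖ ≤ 1 → ψ x = 1) (hψp : ψ (p : ℚ_[p])⁻¹ ≠ 1)
    {f : ℚ_[p] → ℂ} (hf : Continuous f) (hf1 : ∀ x, ‖x‖ ≤ 1 → f x = 1)
    (hadd : ∀ x y, f (x + y) = f x * f y) : ∃ c : ℚ_[p], ∀ x, f x = ψ (c * x) := by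
  have hprime : p.Prime := Fact.out
  have hp0 : (p : ℚ_[p]) ≠ 0 := by exact_mod_cast hprime.ne_zero
  have hpow : ∀ (n : ℕ) x, f (n * x) = f x ^ n := by
    intro n x
    induction n with
    | zero => simp [hf1]
    | succ n ih => rw [Nat.cast_succ, add_mul, one_mul, hadd, ih, pow_succ]
  have hψpow : ∀ (n : ℕ) x, ψ (n * x) = ψ x ^ n := by
    intro n x
    rw [← nsmul_eq_mul, AddChar.map_nsmul_eq_pow]
  have hψc : Continuous fun x => (ψ x : ℂ) :=
    continuous_subtype_val.comp (Padic.addChar_continuous hψ)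
  -- `f` sends p⁻ᵏ to a pᵏ-th root of unity, and ψ(p⁻ᵏ) is a primitive one because ψ(p⁻¹) ≠ 1.
  have hroot : ∀ k : ℕ, ∃ n : ℕ, f ((p : ℚ_[p])⁻¹ ^ k) = ψ (n * (p : ℚ_[p])⁻¹ ^ k) := by
    intro k
    have hk : ((p ^ k : ℕ) : ℚ_[p]) * (p : ℚ_[p])⁻¹ ^ k = 1 := by
      rw [Nat.cast_pow, ← mul_pow, mul_inv_cancel₀ hp0, one_pow]
    have hprim : IsPrimitiveRoot (ψ ((p : ℚ_[p])⁻¹ ^ k) : ℂ) (p ^ k) := by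
      refine IsPrimitiveRoot.map_of_injective (f := Circle.coeHom) ?_ Circle.coe_injective
      cases k with
      | zero => simp [hψ]
      | succ k =>
        rw [← orderOf_eq_prime_pow (p := p) (n := k) (x := ψ ((p : ℚ_[p])⁻¹ ^ (k + 1)))]
        · exact IsPrimitiveRoot.orderOf _
        · rw [← hψpow, pow_succ, ← mul_assoc, Nat.cast_pow, ← mul_pow, mul_inv_cancel₀ hp0,
            one_pow, one_mul]
          exact hψp
        · rw [← hψpow, hk, hψ _ (by simp)]
    have : NeZero (p ^ k) := ⟨pow_ne_zero _ hprime.ne_zero⟩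
    obtain ⟨n, -, hn⟩ := hprim.eq_pow_of_pow_eq_one (ξ := f ((p : ℚ_[p])⁻¹ ^ k))
      (by rw [← hpow, hk, hf1 _ (by simp)])
    exact ⟨n, by rw [hψpow, ← hn, Circle.coe_pow]⟩
  -- Compactness yields one c serving all k: the p-th power of the condition at k + 1 is the
  -- condition at k, so the sets are nested.
  let C : ℕ → Set ℚ_[p] := fun k =>
    {c | f ((p : ℚ_[p])⁻¹ ^ k) = ψ (c * (p : ℚ_[p])⁻¹ ^ k)} ∩ Metric.closedBall 0 1
  have hCcl : ∀ k, IsClosed (C k) := fun k =>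
    (isClosed_eq continuous_const (hψc.comp (by fun_prop))).inter Metric.isClosed_closedBall
  obtain ⟨c, hc⟩ : (⋂ k, C k).Nonempty := by
    refine IsCompact.nonempty_iInter_of_sequence_nonempty_isCompact_isClosed C ?_ ?_ ?_ hCcl
    · rintro k c ⟨h, hb⟩
      refine ⟨?_, hb⟩
      have hk : (p : ℚ_[p])⁻¹ ^ k = (p : ℕ) * (p : ℚ_[p])⁻¹ ^ (k + 1) := by
        rw [pow_succ]; field_simp
      simp only [Set.mem_ofPred_eq] at h ⊢
      rw [hk, hpow, h, mul_left_comm, hψpow, Circle.coe_pow]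
    · intro k
      obtain ⟨n, hn⟩ := hroot k
      exact ⟨n, hn, by simpa using Padic.norm_natCast_le_one n⟩
    · exact (isCompact_closedBall _ _).of_isClosed_subset (hCcl 0) Set.inter_subset_right
  refine ⟨c, fun x => ?_⟩
  have hck : ∀ k : ℕ, f ((p : ℚ_[p])⁻¹ ^ k) = ψ (c * (p : ℚ_[p])⁻¹ ^ k) := fun k =>
    (Set.mem_iInter.1 hc k).1
  have hint : ∀ (k : ℕ) (z : ℤ_[p]),
      f (z * (p : ℚ_[p])⁻¹ ^ k) = ψ (c * (z * (p : ℚ_[p])⁻¹ ^ k)) := by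
    intro k z
    refine congrFun (PadicInt.denseRange_natCast.equalizer
      (g := fun z : ℤ_[p] => f (z * (p : ℚ_[p])⁻¹ ^ k))
      (h := fun z : ℤ_[p] => (ψ (c * (z * (p : ℚ_[p])⁻¹ ^ k)) : ℂ)) ?_ ?_ ?_) z
    · exact hf.comp (continuous_subtype_val.mul continuous_const)
    · exact hψc.comp (continuous_const.mul (continuous_subtype_val.mul continuous_const))
    · funext n
      simp only [Function.comp_apply, PadicInt.coe_natCast]
      rw [hpow, hck, mul_left_comm, hψpow, Circle.coe_pow]
  obtain ⟨k, hk⟩ := pow_unbounded_of_one_lt ‖x‖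
    (show (1 : ℝ) < p by exact_mod_cast hprime.one_lt)
  have hz : ‖x * (p : ℚ_[p]) ^ k‖ ≤ 1 := by
    rw [norm_mul, norm_pow, Padic.norm_p, inv_pow]
    rw [← div_eq_mul_inv]
    exact div_le_one_of_le₀ hk.le (by positivity)
  have := hint k ⟨_, hz⟩
  have hx : x * (p : ℚ_[p]) ^ k * (p : ℚ_[p])⁻¹ ^ k = x := by
    rw [mul_assoc, ← mul_pow, mul_inv_cancel₀ hp0, one_pow, mul_one]
  simpa only [hx] using this

/-- Every continuous multiplicative function on `ℚ_[p]` has the form `x ↦ ψ (c * x)`. -/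
theorem Padic.exists_eq_addChar {ψ : AddChar ℚ_[p] Circle}
    (hψ : ∀ x, ‖x‖ ≤ 1 → ψ x = 1) (hψp : ψ (p : ℚ_[p])⁻¹ ≠ 1)
    {f : ℚ_[p] → ℂ} (hf : Continuous f) (h0 : f 0 = 1)
    (hadd : ∀ x y, f (x + y) = f x * f y) : ∃ c : ℚ_[p], ∀ x, f x = ψ (c * x) := by
  have hprime : p.Prime := Fact.out
  have hp0 : (p : ℚ_[p]) ≠ 0 := by exact_mod_cast hprime.ne_zero
  have hpow : ∀ (n : ℕ) x, f (n * x) = f x ^ n := by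
    intro n x
    induction n with
    | zero => simp [h0]
    | succ n ih => rw [Nat.cast_succ, add_mul, one_mul, hadd, ih, pow_succ]
  obtain ⟨ε, hε, hball⟩ := Metric.continuousAt_iff.1 (hf.continuousAt (x := 0)) (1 / 2)
    (by norm_num)
  -- No small subgroups: balls about 0 are stable under integer multiples, so all powers of `f x`
  -- stay near 1.
  have hsmall : ∀ x, ‖x‖ < ε → f x = 1 := by
    intro x hx
    refine Complex.eq_one_of_norm_pow_sub_one_le fun n => ?_
    have := hball (x := n * x) (by
      rw [dist_zero_right, norm_mul]
      exact (mul_le_of_le_one_left (norm_nonneg _) (Padic.norm_natCast_le_one n)).trans_lt hx)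
    rw [h0, hpow, dist_eq_norm] at this
    exact this.le
  obtain ⟨q, hq0, hq⟩ := NormedField.exists_norm_lt ℚ_[p] hε
  have hq0' : q ≠ 0 := norm_pos_iff.1 hq0
  obtain ⟨c, hc⟩ := Padic.exists_eq_addChar_of_trivial hψ hψp (f := fun x => f (q * x))
    (hf.comp (by fun_prop)) (fun x hx => hsmall _ (by
      rw [norm_mul]
      exact (mul_le_of_le_one_right (norm_nonneg _) hx).trans_lt hq))
    (fun x y => by rw [mul_add, hadd])
  refine ⟨c * q⁻¹, fun x => ?_⟩
  rw [mul_assoc, ← hc, mul_inv_cancel_left₀ hq0']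

end

/-! ### Uniqueness of the Fourier transform -/

open MeasureTheory BoundedContinuousFunction in
/-- A finite measure on `ℚ_[p]` is determined by the integrals of the characters `x ↦ ψ (t * x)`,
where `ψ` is a fixed nontrivial continuous character. -/
theorem MeasureTheory.Measure.ext_of_integral_addChar_mul_eq {p : ℕ} [Fact p.Prime]
    [MeasurableSpace ℚ_[p]] [BorelSpace ℚ_[p]] {ψ : AddChar ℚ_[p] Circle} (hψc : Continuous ψ)
    (hψ1 : ψ ≠ 1) {μ ν : Measure ℚ_[p]} [IsFiniteMeasure μ] [IsFiniteMeasure ν]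
    (h : ∀ t, ∫ x, (ψ (t * x) : ℂ) ∂μ = ∫ x, (ψ (t * x) : ℂ) ∂ν) : μ = ν := by
  let e : Multiplicative ℚ_[p] →* (ℚ_[p] →ᵇ ℂ) :=
    { toFun := fun t => BoundedContinuousFunction.ofNormedAddCommGroup
        (fun x => (ψ (t.toAdd * x) : ℂ))
        (continuous_subtype_val.comp (hψc.comp (by fun_prop))) 1 (fun x => (Circle.norm_coe _).le)
      map_one' := by ext x; simp
      map_mul' := fun s t => by ext x; simp [add_mul, AddChar.map_add_eq_mul] }
  have he : ∀ t x, e t x = (ψ (t.toAdd * x) : ℂ) := fun _ _ => rfl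
  let S : Submonoid (ℚ_[p] →ᵇ ℂ) := MonoidHom.mrange e
  have hstar : ∀ f ∈ Algebra.adjoin ℂ (S : Set (ℚ_[p] →ᵇ ℂ)),
      star f ∈ Algebra.adjoin ℂ (S : Set (ℚ_[p] →ᵇ ℂ)) := by
    intro f hf
    induction hf using Algebra.adjoin_induction with
    | mem f hf =>
      obtain ⟨t, rfl⟩ := hf
      refine Algebra.subset_adjoin ⟨t⁻¹, ?_⟩
      ext x
      simp [he, AddChar.map_neg_eq_inv, ← Circle.coe_inv_eq_conj]
    | algebraMap r =>
      rw [← algebraMap_star_comm]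
      exact Subalgebra.algebraMap_mem _ _
    | add f g _ _ hf hg => rw [star_add]; exact add_mem hf hg
    | mul f g _ _ hf hg => rw [star_mul]; exact mul_mem hg hf
  let A : StarSubalgebra ℂ (ℚ_[p] →ᵇ ℂ) :=
    { toSubalgebra := Algebra.adjoin ℂ (S : Set (ℚ_[p] →ᵇ ℂ)), star_mem' := fun hf => hstar _ hf }
  refine ext_of_forall_mem_subalgebra_integral_eq_of_pseudoEMetric_complete_countable (𝕜 := ℂ)
    (A := A) ?_ ?_
  · intro x y hxy
    obtain ⟨z, hz⟩ := AddChar.ne_one_iff.1 hψ1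
    let t := z / (x - y)
    refine ⟨e (Multiplicative.ofAdd t), ⟨(e (Multiplicative.ofAdd t)).toContinuousMap,
      ⟨e (Multiplicative.ofAdd t), Algebra.subset_adjoin ⟨_, rfl⟩, rfl⟩, rfl⟩, fun heq => hz ?_⟩
    rw [he, he, Circle.coe_inj] at heq
    have : z = t * x - t * y := by
      rw [← mul_sub]
      exact (div_mul_cancel₀ _ (sub_ne_zero.2 hxy)).symm
    rw [this, AddChar.map_sub_eq_div]
    exact div_eq_one.2 heq
  · intro f hf
    -- The characters are closed under products, so the algebra they generate is their linear span.
    have hf' : f ∈ Submodule.span ℂ (S : Set (ℚ_[p] →ᵇ ℂ)) := by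
      have : f ∈ Subalgebra.toSubmodule (Algebra.adjoin ℂ (S : Set (ℚ_[p] →ᵇ ℂ))) := hf
      rwa [Algebra.adjoin_eq_span, Submonoid.closure_eq] at this
    clear hf
    induction hf' using Submodule.span_induction with
    | mem f hf =>
      obtain ⟨t, rfl⟩ := hf
      exact h _
    | zero => simp
    | add f g _ _ hf hg =>
      simp only [BoundedContinuousFunction.add_apply]
      rw [integral_add (f.integrable μ) (g.integrable μ),
        integral_add (f.integrable ν) (g.integrable ν), hf, hg]
    | smul c f _ hf =>
      simp only [BoundedContinuousFunction.smul_apply]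
      rw [integral_smul, integral_smul, hf]

/-! ### The functional equations -/

section

open scoped ComplexConjugate

variable {p : ℕ} [Fact p.Prime]

/-- A Hermitian function all of whose multiplicative third differences are trivial is
multiplicative. -/
theorem Padic.map_add_of_third_difference {h : ℚ_[p] → ℂ} (hc : Continuous h)
    (hne : ∀ x, h x ≠ 0) (h0 : h 0 = 1) (hconj : ∀ x, h (-x) = conj (h x))
    (hdiff : ∀ x y r, h (x + y + r) * h x * h y * h r = h (x + y) * h (x + r) * h (y + r))
    (x y : ℚ_[p]) : h (x + y) = h x * h y := by
  -- `χ` measures the failure of multiplicativity; `hdiff` makes it a symmetric bicharacter.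
  set χ : ℚ_[p] → ℚ_[p] → ℂ := fun r x => h (x + r) / (h x * h r) with hχ
  have hχc : ∀ r, Continuous (χ r) := fun r =>
    (hc.comp (by fun_prop)).div (hc.mul continuous_const) fun x => mul_ne_zero (hne x) (hne r)
  have hχ0 : ∀ r, χ r 0 = 1 := fun r => by
    simp only [hχ, zero_add, h0, one_mul]
    exact div_self (hne r)
  have hχadd : ∀ r x y, χ r (x + y) = χ r x * χ r y := by
    intro r x y
    have h1 := hne x
    have h2 := hne y
    have h3 := hne r
    have h4 := hne (x + y)
    simp only [hχ]
    field_simp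
    linear_combination hdiff x y r
  have hχsymm : ∀ x y, χ x y = χ y x := fun x y => by
    simp only [hχ, add_comm y x, mul_comm (h y)]
  have hnorm : ∀ x, ‖h x‖ = 1 := by
    intro x
    have hmul : ∀ x y, ‖h (x + y)‖ = ‖h x‖ * ‖h y‖ := fun x y => by
      have h1 := Padic.norm_eq_one_of_map_add (hχc y) (hχ0 y) (hχadd y) x
      simp only [hχ, norm_div, norm_mul] at h1
      rwa [div_eq_one_iff_eq (mul_ne_zero (norm_ne_zero_iff.2 (hne x))
        (norm_ne_zero_iff.2 (hne y)))] at h1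
    have h1 := hmul x (-x)
    rw [add_neg_cancel, h0, hconj, RCLike.norm_conj, norm_one] at h1
    nlinarith [norm_nonneg (h x)]
  have hdiag : ∀ x, χ x x = 1 := by
    intro x
    have h1 : χ x (-x) = 1 := by
      simp only [hχ, neg_add_cancel, h0, hconj]
      rw [mul_comm, Complex.mul_conj, Complex.normSq_eq_norm_sq, hnorm]
      simp
    have h2 := hχadd x x (-x)
    rw [add_neg_cancel, hχ0, h1, mul_one] at h2
    exact h2.symm
  have hsq : ∀ x y, χ x y * χ x y = 1 := by
    intro x y
    have h1 := hdiag (x + y)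
    rw [hχadd, hχsymm _ x, hχsymm _ y, hχadd, hχadd, hdiag, hdiag, hχsymm y x] at h1
    simpa using h1
  have h1 : χ y x = 1 := by
    -- An alternating symmetric bicharacter has square 1, hence is trivial as ℚ_p is 2-divisible.
    rw [← add_halves x, hχadd, hsq]
  exact (div_eq_one_iff_eq (mul_ne_zero (hne x) (hne y))).1 h1

/-- If a function of `a * u + b * v` times a function of a linear form that is not proportional to
it splits as a function of `u` times a function of `v`, then the first function has trivial
multiplicative third differences. -/
theorem third_difference_of_split {K : Type*} [Field K] {h k A B : K → ℂ} {a b a' b' : K}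
    (ha : a ≠ 0) (hb : b ≠ 0) (hdet : a * b' ≠ a' * b) (hk : ∀ x, k x ≠ 0) (h0 : h 0 = 1)
    (heq : ∀ u v, h (a * u + b * v) * k (a' * u + b' * v) = A u * B v) (x y r : K) :
    h (x + y + r) * h x * h y * h r = h (x + y) * h (x + r) * h (y + r) := by
  have hD : a * b' - a' * b ≠ 0 := sub_ne_zero.2 hdet
  set D := a * b' - a' * b with hDdef
  have e0 : ∀ s t, h (s + t) * k (a' * (s / a) + b' * (t / b)) = A (s / a) * B (t / b) := by
    intro s t
    rw [← heq, mul_div_cancel₀ _ ha, mul_div_cancel₀ _ hb]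
  -- Moving (u, v) by (b'r/D, -a'r/D) fixes a'u + b'v and adds r to au + bv.
  have e1 : ∀ s t, h (s + t + r) * k (a' * (s / a) + b' * (t / b)) =
      A (s / a + b' * r / D) * B (t / b - a' * r / D) := by
    intro s t
    rw [← heq]
    congr 2
    · field_simp
      rw [hDdef]; ring
    · ring
  have k1 := hk (a' * (x / a) + b' * (y / b))
  have k2 := hk (a' * (x / a) + b' * (0 / b))
  have k3 := hk (a' * (0 / a) + b' * (y / b))
  have k4 := hk (a' * (0 / a) + b' * (0 / b))
  have p1 := e0 x y
  have p2 := e0 x 0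
  have p3 := e0 0 y
  have p4 := e0 0 0
  have q1 := e1 x y
  have q2 := e1 x 0
  have q3 := e1 0 y
  have q4 := e1 0 0
  simp only [add_zero, zero_add, h0] at p1 p2 p3 p4 q1 q2 q3 q4
  set K₁ := k (a' * (x / a) + b' * (y / b))
  set K₂ := k (a' * (x / a) + b' * (0 / b))
  set K₃ := k (a' * (0 / a) + b' * (y / b))
  set K₄ := k (a' * (0 / a) + b' * (0 / b))
  refine mul_right_cancel₀ (mul_ne_zero (mul_ne_zero (mul_ne_zero k1 k2) k3) k4) ?_
  calc h (x + y + r) * h x * h y * h r * (K₁ * K₂ * K₃ * K₄) =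
      (h (x + y + r) * K₁) * (h x * K₂) * (h y * K₃) * (h r * K₄) := by ring
    _ = (h (x + y) * K₁) * (h (x + r) * K₂) * (h (y + r) * K₃) * (1 * K₄) := by
      rw [q1, p2, p3, q4, p1, q2, q3, p4]; ring
    _ = _ := by ring

/-- If `|α| ≠ 1`, a continuous `h` for which `h s * h (α * s)` is multiplicative is a character. -/
theorem Padic.exists_eq_addChar_of_mul_comp {ψ : AddChar ℚ_[p] Circle} (hψc : Continuous ψ)
    {h : ℚ_[p] → ℂ} (hc : Continuous h) (h0 : h 0 = 1) {α c : ℚ_[p]} (hα0 : α ≠ 0)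
    (hα : ‖α‖ ≠ 1) (heq : ∀ s, h s * h (α * s) = ψ (c * s)) : ∃ d, ∀ s, h s = ψ (d * s) := by
  have h1α : 1 + α ≠ 0 := by
    intro h1
    apply hα
    rw [← neg_eq_of_add_eq_zero_right h1, norm_neg, norm_one]
  -- This d solves d + dα = c, so dividing h by ψ(d·) reduces to a trivial right-hand side.
  set d := c / (1 + α) with hd
  set k : ℚ_[p] → ℂ := fun s => h s * ψ (-(d * s)) with hk
  have hkc : Continuous k :=
    hc.mul (continuous_subtype_val.comp (hψc.comp (by fun_prop)))
  have hk0 : k 0 = 1 := by simp [hk, h0]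
  have hkk : ∀ s, k s * k (α * s) = 1 := by
    intro s
    have h1 : -(d * s) + -(d * (α * s)) = -(c * s) := by
      rw [hd]; field_simp; ring
    calc k s * k (α * s) = (h s * h (α * s)) * (ψ (-(d * s)) * ψ (-(d * (α * s))) : Circle) := by
          simp only [hk, Circle.coe_mul]; ring
      _ = (ψ (c * s + -(c * s)) : Circle) := by
          rw [heq, ← AddChar.map_add_eq_mul, h1, AddChar.map_add_eq_mul, Circle.coe_mul]
      _ = 1 := by simp
  have hper : ∀ s, k (α ^ 2 * s) = k s := by
    intro s
    have h1 := hkk s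
    have h2 : k (α * s) * k (α ^ 2 * s) = 1 := by
      have h3 := hkk (α * s)
      rwa [show α * (α * s) = α ^ 2 * s by ring] at h3
    have h3 : k (α * s) ≠ 0 := right_ne_zero_of_mul_eq_one h1
    exact mul_left_cancel₀ h3 (by rw [h2, mul_comm, h1])
  have hiter : ∀ (n : ℕ) s, k ((α ^ 2) ^ n * s) = k s := by
    intro n s
    induction n with
    | zero => simp
    | succ n ih => rw [pow_succ', mul_assoc, hper, ih]
  have hlim : ∀ β : ℚ_[p], ‖β‖ < 1 → (∀ (n : ℕ) s, k (β ^ n * s) = k s) → ∀ s, k s = 1 := by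
    intro β hβ hβk s
    have h1 : Filter.Tendsto (fun n : ℕ => k (β ^ n * s)) Filter.atTop (nhds (k (0 * s))) :=
      (hkc.tendsto _).comp ((tendsto_pow_atTop_nhds_zero_of_norm_lt_one hβ).mul_const s)
    simp only [hβk, zero_mul, hk0] at h1
    exact tendsto_nhds_unique tendsto_const_nhds h1
  have hk1 : ∀ s, k s = 1 := by
    rcases lt_or_gt_of_ne hα with h1 | h1
    · exact hlim (α ^ 2) (by rw [norm_pow]; exact pow_lt_one₀ (norm_nonneg _) h1 two_ne_zero) hiter
    · refine hlim (α ^ 2)⁻¹ ?_ ?_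
      · rw [norm_inv, norm_pow]
        exact inv_lt_one_of_one_lt₀ (one_lt_pow₀ h1 two_ne_zero)
      · intro n s
        have h2 : (α ^ 2) ^ n ≠ 0 := pow_ne_zero _ (pow_ne_zero _ hα0)
        rw [← hiter n, inv_pow, mul_inv_cancel_left₀ h2]
  refine ⟨d, fun s => ?_⟩
  have h1 := hk1 s
  simp only [hk, AddChar.map_neg_eq_inv, Circle.coe_inv] at h1
  exact eq_of_mul_inv_eq_one h1

end

/-! ### Characteristic functions on ℚ_p -/

section

open MeasureTheory ProbabilityTheory
open scoped ComplexConjugate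

variable {p : ℕ} [Fact p.Prime]

theorem continuous_coe_addChar_mul {ψ : AddChar ℚ_[p] Circle} (hψc : Continuous ψ) (t : ℚ_[p]) :
    Continuous fun x => (ψ (t * x) : ℂ) :=
  continuous_subtype_val.comp (hψc.comp (by fun_prop))

variable [MeasurableSpace ℚ_[p]]

/-- The characteristic function of a measure on `ℚ_[p]`, with the dual group parametrized by
`ℚ_[p]` through an additive character `ψ`. -/
noncomputable def padicCharFun (ψ : AddChar ℚ_[p] Circle) (μ : Measure ℚ_[p]) (t : ℚ_[p]) : ℂ :=
  ∫ x, (ψ (t * x) : ℂ) ∂μ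

variable {ψ : AddChar ℚ_[p] Circle} {μ ν : Measure ℚ_[p]}

theorem padicCharFun_eq_groupCharFun (hψc : Continuous ψ) (μ : Measure ℚ_[p]) (t : ℚ_[p]) :
    ∃ y, padicCharFun ψ μ t = groupCharFun μ y := by
  let y : Multiplicative ℚ_[p] →ₜ* Circle :=
    { toFun := fun x => ψ (t * x.toAdd)
      map_one' := by simp
      map_mul' := fun x y => by simp [mul_add, AddChar.map_add_eq_mul]
      continuous_toFun := hψc.comp (continuous_const.mul continuous_toAdd) }
  exact ⟨y, rfl⟩

theorem padicCharFun_zero [IsProbabilityMeasure μ] : padicCharFun ψ μ 0 = 1 := by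
  simp [padicCharFun]

theorem padicCharFun_neg (t : ℚ_[p]) : padicCharFun ψ μ (-t) = conj (padicCharFun ψ μ t) := by
  simp only [padicCharFun]
  rw [← integral_conj]
  congr 1
  funext x
  rw [neg_mul, AddChar.map_neg_eq_inv, Circle.coe_inv_eq_conj]

variable [BorelSpace ℚ_[p]]

theorem continuous_padicCharFun [IsFiniteMeasure μ] (hψc : Continuous ψ) :
    Continuous (padicCharFun ψ μ) := by
  refine continuous_of_dominated (bound := fun _ => 1) ?_ ?_ (integrable_const _) ?_
  · exact fun t => (continuous_coe_addChar_mul hψc t).aestronglyMeasurable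
  · exact fun t => Filter.Eventually.of_forall fun x => (Circle.norm_coe _).le
  · exact Filter.Eventually.of_forall fun x =>
      continuous_subtype_val.comp (hψc.comp (continuous_id.mul continuous_const))

theorem padicCharFun_map_add_const (hψc : Continuous ψ) (c t : ℚ_[p]) :
    padicCharFun ψ (μ.map fun x => x + c) t = ψ (c * t) * padicCharFun ψ μ t := by
  simp only [padicCharFun]
  rw [integral_map (by fun_prop) (continuous_coe_addChar_mul hψc t).aestronglyMeasurable,
    ← integral_const_mul]
  congr 1
  funext x
  rw [← Circle.coe_mul, ← AddChar.map_add_eq_mul]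
  congr 2
  ring

theorem isShiftOf_of_padicCharFun_eq (hψc : Continuous ψ) (hψ1 : ψ ≠ 1) [IsFiniteMeasure μ]
    [IsFiniteMeasure ν] {c : ℚ_[p]}
    (h : ∀ t, padicCharFun ψ ν t = ψ (c * t) * padicCharFun ψ μ t) : IsShiftOf ν μ :=
  ⟨c, Measure.ext_of_integral_addChar_mul_eq hψc hψ1 fun t =>
    (h t).trans (padicCharFun_map_add_const hψc c t).symm⟩

/-- The characteristic function of a pair of linear forms in independent random variables. -/
theorem integral_addChar_linear_forms {Ω : Type*} [MeasurableSpace Ω] {P : Measure Ω}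
    {ξ : Fin 4 → Ω → ℚ_[p]} (hm : ∀ j, Measurable (ξ j)) (hi : iIndepFun ξ P)
    (hψc : Continuous ψ) (a₂ a₃ b₂ b₃ u v : ℚ_[p]) :
    ∫ z : ℚ_[p] × ℚ_[p], (ψ (u * z.1 + v * z.2) : ℂ) ∂(P.map fun ω =>
      (ξ 0 ω + a₂ * ξ 1 ω + a₃ * ξ 2 ω, b₂ * ξ 1 ω + b₃ * ξ 2 ω + ξ 3 ω)) =
    padicCharFun ψ (P.map (ξ 0)) u * padicCharFun ψ (P.map (ξ 1)) (a₂ * u + b₂ * v) *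
      padicCharFun ψ (P.map (ξ 2)) (a₃ * u + b₃ * v) * padicCharFun ψ (P.map (ξ 3)) v := by
  have h0 := hm 0
  have h1 := hm 1
  have h2 := hm 2
  have h3 := hm 3
  let t : Fin 4 → ℚ_[p] := ![u, a₂ * u + b₂ * v, a₃ * u + b₃ * v, v]
  have hprod := hi.integral_fun_prod_comp (f := fun j x => (ψ (t j * x) : ℂ))
    (fun j => (hm j).aemeasurable)
    (fun j => (continuous_coe_addChar_mul hψc (t j)).aestronglyMeasurable)
  have hF : ∀ j, ∫ ω, (ψ (t j * ξ j ω) : ℂ) ∂P = padicCharFun ψ (P.map (ξ j)) (t j) := fun j =>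
    (integral_map (hm j).aemeasurable
      (continuous_coe_addChar_mul hψc (t j)).aestronglyMeasurable).symm
  simp only [hF, Fin.prod_univ_four] at hprod
  rw [integral_map]
  · refine Eq.trans ?_ hprod
    congr 1
    funext ω
    simp only [← Circle.coe_mul, ← AddChar.map_add_eq_mul, t]
    congr 2
    simp
    ring
  · fun_prop
  · exact (continuous_subtype_val.comp (hψc.comp (by fun_prop))).aestronglyMeasurable

end

/-! ### The main theorem -/

/-- The random variables `ξ₁, ξ₂, ξ₃, ξ₄` are `ξ 0, ξ 1, ξ 2, ξ 3`, and similarly for `η`. That the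
law of `(L₁, L₂)` determines the laws of the `ξⱼ` up to shift means: if a second system `η`
satisfies the same assumptions and gives the same law of the pair of linear forms, then the law of
each `ηⱼ` is a shift of the law of `ξⱼ`. -/
theorem theorem3p2 (p : ℕ) [Fact p.Prime] [MeasurableSpace ℚ_[p]] [BorelSpace ℚ_[p]]
    {Ω Ω' : Type*} [MeasurableSpace Ω] [MeasurableSpace Ω']
    (P : MeasureTheory.Measure Ω) [MeasureTheory.IsProbabilityMeasure P]
    (Q : MeasureTheory.Measure Ω') [MeasureTheory.IsProbabilityMeasure Q]
    (ξ : Fin 4 → Ω → ℚ_[p]) (η : Fin 4 → Ω' → ℚ_[p])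
    (hξm : ∀ j, Measurable (ξ j)) (hηm : ∀ j, Measurable (η j))
    (hξi : ProbabilityTheory.iIndepFun ξ P) (hηi : ProbabilityTheory.iIndepFun η Q)
    (hξc : ∀ j y, groupCharFun (P.map (ξ j)) y ≠ 0)
    (hηc : ∀ j y, groupCharFun (Q.map (η j)) y ≠ 0)
    (a₂ a₃ b₂ b₃ : ℚ_[p]) (ha₂ : a₂ ≠ 0) (ha₃ : a₃ ≠ 0) (hb₂ : b₂ ≠ 0) (hb₃ : b₃ ≠ 0)
    (hcond : a₂ * b₃ ≠ a₃ * b₂ ∨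
      (a₂ * b₃ = a₃ * b₂ ∧ ‖a₂‖ ≠ ‖a₃‖ ∧
        ProbabilityTheory.IdentDistrib (ξ 1) (ξ 2) P P ∧
        ProbabilityTheory.IdentDistrib (η 1) (η 2) Q Q))
    (hlaw :
      P.map (fun ω => (ξ 0 ω + a₂ * ξ 1 ω + a₃ * ξ 2 ω, b₂ * ξ 1 ω + b₃ * ξ 2 ω + ξ 3 ω)) =
      Q.map (fun ω => (η 0 ω + a₂ * η 1 ω + a₃ * η 2 ω, b₂ * η 1 ω + b₃ * η 2 ω + η 3 ω))) :
    ∀ j, IsShiftOf (Q.map (η j)) (P.map (ξ j)) := by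
  obtain ⟨ψ, hψ, hψp⟩ := Padic.exists_addChar p
  have hψc := Padic.addChar_continuous hψ
  have hψ1 : ψ ≠ 1 := AddChar.ne_one_iff.2 ⟨_, hψp⟩
  have hPξ : ∀ j, MeasureTheory.IsProbabilityMeasure (P.map (ξ j)) := fun j =>
    MeasureTheory.Measure.isProbabilityMeasure_map (hξm j).aemeasurable
  have hQη : ∀ j, MeasureTheory.IsProbabilityMeasure (Q.map (η j)) := fun j =>
    MeasureTheory.Measure.isProbabilityMeasure_map (hηm j).aemeasurable
  have hξne : ∀ j t, padicCharFun ψ (P.map (ξ j)) t ≠ 0 := fun j t => by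
    obtain ⟨y, hy⟩ := padicCharFun_eq_groupCharFun hψc (P.map (ξ j)) t
    rw [hy]
    exact hξc j y
  have hηne : ∀ j t, padicCharFun ψ (Q.map (η j)) t ≠ 0 := fun j t => by
    obtain ⟨y, hy⟩ := padicCharFun_eq_groupCharFun hψc (Q.map (η j)) t
    rw [hy]
    exact hηc j y
  obtain ⟨h, hdef⟩ : ∃ h : Fin 4 → ℚ_[p] → ℂ, ∀ j t,
      h j t = padicCharFun ψ (Q.map (η j)) t / padicCharFun ψ (P.map (ξ j)) t := ⟨_, fun _ _ => rfl⟩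
  have hc : ∀ j, Continuous (h j) := fun j => by
    rw [funext (hdef j)]
    exact (continuous_padicCharFun hψc).div (continuous_padicCharFun hψc) (hξne j)
  have hne : ∀ j t, h j t ≠ 0 := fun j t => by
    rw [hdef]
    exact div_ne_zero (hηne j t) (hξne j t)
  have h0 : ∀ j, h j 0 = 1 := fun j => by
    rw [hdef, padicCharFun_zero, padicCharFun_zero, div_one]
  have hconj : ∀ j t, h j (-t) = starRingEnd ℂ (h j t) := fun j t => by
    rw [hdef, hdef, padicCharFun_neg, padicCharFun_neg, map_div₀]
  have heq : ∀ u v, h 0 u * h 1 (a₂ * u + b₂ * v) * h 2 (a₃ * u + b₃ * v) * h 3 v = 1 := by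
    intro u v
    have h1 := integral_addChar_linear_forms hξm hξi hψc a₂ a₃ b₂ b₃ u v
    rw [hlaw, integral_addChar_linear_forms hηm hηi hψc] at h1
    simp only [hdef, div_mul_div_comm]
    rw [h1]
    exact div_self (mul_ne_zero (mul_ne_zero (mul_ne_zero (hξne _ _) (hξne _ _)) (hξne _ _))
      (hξne _ _))
  have hu : ∀ u, h 0 u * (h 1 (a₂ * u) * h 2 (a₃ * u)) = 1 := fun u => by
    simpa [h0, mul_assoc] using heq u 0
  have hv : ∀ v, h 3 v * (h 1 (b₂ * v) * h 2 (b₃ * v)) = 1 := fun v => by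
    have h1 := heq 0 v
    simp only [h0, mul_zero, zero_add, one_mul] at h1
    rw [mul_comm, h1]
  have hsplit : ∀ u v, h 1 (a₂ * u + b₂ * v) * h 2 (a₃ * u + b₃ * v) =
      (h 1 (a₂ * u) * h 2 (a₃ * u)) * (h 1 (b₂ * v) * h 2 (b₃ * v)) := by
    intro u v
    refine mul_left_cancel₀ (mul_ne_zero (hne 0 u) (hne 3 v)) ?_
    calc _ = 1 := by rw [← heq u v]; ring
      _ = (h 0 u * (h 1 (a₂ * u) * h 2 (a₃ * u))) * (h 3 v * (h 1 (b₂ * v) * h 2 (b₃ * v))) := by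
        rw [hu, hv, one_mul]
      _ = _ := by ring
  have hchar : (∃ c, ∀ t, h 1 t = ψ (c * t)) ∧ ∃ c, ∀ t, h 2 t = ψ (c * t) := by
    rcases hcond with hdet | ⟨hdet, hnorm, hξid, hηid⟩
    · constructor
      · exact Padic.exists_eq_addChar hψ hψp (hc 1) (h0 1) (Padic.map_add_of_third_difference
          (hc 1) (hne 1) (h0 1) (hconj 1)
          (third_difference_of_split ha₂ hb₂ hdet (hne 2) (h0 1) hsplit))
      · exact Padic.exists_eq_addChar hψ hψp (hc 2) (h0 2) (Padic.map_add_of_third_difference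
          (hc 2) (hne 2) (h0 2) (hconj 2)
          (third_difference_of_split ha₃ hb₃ hdet.symm (hne 1) (h0 2) fun u v =>
            (mul_comm _ _).trans (hsplit u v)))
    · have h21 : h 2 = h 1 := by
        funext t
        rw [hdef, hdef, hξid.map_eq, hηid.map_eq]
      rw [h21] at hsplit ⊢
      rw [and_self]
      set α := a₃ / a₂ with hα
      have ha : ∀ s, a₃ * (s / a₂) = α * s := fun s => by rw [hα]; ring
      have hb : ∀ s, b₃ * (s / b₂) = α * s := fun s => by
        have : b₃ / b₂ = α := by
          rw [hα, div_eq_div_iff hb₂ ha₂, mul_comm, hdet]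
        rw [← this]; ring
      obtain ⟨c, hc'⟩ := Padic.exists_eq_addChar hψ hψp (f := fun s => h 1 s * h 1 (α * s))
        ((hc 1).mul ((hc 1).comp (by fun_prop))) (by simp [h0]) (fun s t => by
          -- These arguments turn both linear forms into multiples of s + t, by 1 and by α.
          have h1 := hsplit (s / a₂) (t / b₂)
          rw [mul_div_cancel₀ _ ha₂, mul_div_cancel₀ _ hb₂, ha, hb, ← mul_add] at h1
          exact h1)
      refine Padic.exists_eq_addChar_of_mul_comp hψc (hc 1) (h0 1) (div_ne_zero ha₃ ha₂) ?_ hc'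
      rw [norm_div, Ne, div_eq_one_iff_eq (norm_ne_zero_iff.2 ha₂)]
      exact hnorm.symm
  obtain ⟨⟨c₁, hc₁⟩, c₂, hc₂⟩ := hchar
  have hinv : ∀ (f : ℚ_[p] → ℂ) (a b : ℚ_[p]), (∀ u, f u * (h 1 (a * u) * h 2 (b * u)) = 1) →
      ∃ c, ∀ t, f t = ψ (c * t) := by
    intro f a b hf
    refine ⟨-(c₁ * a + c₂ * b), fun t => ?_⟩
    rw [eq_inv_of_mul_eq_one_left (hf t), hc₁, hc₂, ← Circle.coe_mul, ← AddChar.map_add_eq_mul,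
      ← Circle.coe_inv, ← AddChar.map_neg_eq_inv]
    congr 2
    ring
  have hall : ∀ j, ∃ c, ∀ t, h j t = ψ (c * t) := by
    intro j
    fin_cases j
    · exact hinv _ _ _ hu
    · exact ⟨c₁, hc₁⟩
    · exact ⟨c₂, hc₂⟩
    · exact hinv _ _ _ hv
  intro j
  obtain ⟨c, hcj⟩ := hall j
  refine isShiftOf_of_padicCharFun_eq hψc hψ1 (c := c) fun t => ?_
  rw [← hcj, hdef, div_mul_cancel₀ _ (hξne j t)]
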